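/- Let $\alpha>0$ be a constant and let $x,y:[0,\infty)\to\mathbb{R}$ be a nonnegative solution of the planar system $$\dot y=\alpha-xy,\qquad \dot x=\alpha-x^2-xy,$$ that is, $x$ and $y$ are differentiable on $[0,\infty)$ (one-sidedly at $t=0$), satisfy both equations for all $t\ge 0$, and $x(t)\ge 0$, $y(t)\ge 0$ for all $t\ge 0$. Then: (i) $\displaystyle\lim_{t\to+\infty}\left(\frac{3}{\alpha}t\right)^{1/3}x(t)=1$; (ii) $\displaystyle\lim_{t\to+\infty}\left(3\alpha^2t\right)^{-1/3}y(t)=1$; (iii) $\displaystyle\lim_{t\to+\infty}\left(\frac{3}{\alpha}t\right)^{2/3}\bigl(\alpha-x(t)y(t)\bigr)=1$. -/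

import Mathlib

open Filter Topology

/-- `(x, y)` is a nonnegative solution on `[0, ∞)` of the planar system
`y' = α - x y`, `x' = α - x² - x y` (one-sided derivatives at `t = 0`; for `t > 0` the
derivative within `[0, ∞)` is the ordinary two-sided derivative). -/
structure IsNonnegSolution (α : ℝ) (x y : ℝ → ℝ) : Prop where
  deriv_y : ∀ t : ℝ, 0 ≤ t → HasDerivWithinAt y (α - x t * y t) (Set.Ici 0) t
  deriv_x : ∀ t : ℝ, 0 ≤ t → HasDerivWithinAt x (α - x t ^ 2 - x t * y t) (Set.Ici 0) t
  nonneg_x : ∀ t : ℝ, 0 ≤ t → 0 ≤ x t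
  nonneg_y : ∀ t : ℝ, 0 ≤ t → 0 ≤ y t

/-! Since `(y - x)' = x²`, the difference `y - x` is nondecreasing, and it cannot stay bounded, so
`y → ∞`. Then `x`, `x y` and `(α - x y) y²` each satisfy a relaxation equation `f' = a (g - f)` with
`a → ∞` and `g` convergent, so they tend to `0`, `α` and `α²` (`tendsto_of_hasDerivAt_relaxation`).
Hence `(y³)' = 3 (α - x y) y² → 3 α²`, which gives `y³ / t → 3 α²`, that is (ii). Dividing the
limits of `x y` and `(α - x y) y²` by `y` and `y²` gives (i) and (iii). -/

/-- A function with `f' ≤ a (b - f)`, where `a` is bounded below by a positive constant, is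
eventually below every level above `b`. -/
theorem eventually_lt_of_deriv_le {f f' a : ℝ → ℝ} {a₀ b c : ℝ} (ha₀ : 0 < a₀) (hbc : b < c)
    (hf : ∀ᶠ t in atTop, HasDerivAt f (f' t) t) (ha : ∀ᶠ t in atTop, a₀ ≤ a t)
    (hf' : ∀ᶠ t in atTop, f' t ≤ a t * (b - f t)) : ∀ᶠ t in atTop, f t < c := by
  obtain ⟨T, hT⟩ := eventually_atTop.1 (hf.and (ha.and hf'))
  obtain ⟨d, hbd, hdc⟩ := exists_between hbc
  set K := |f T - d| with hK
  have hBd : ∀ t, HasDerivAt (fun t => d + K * Real.exp (-a₀ * (t - T)))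
      (K * (Real.exp (-a₀ * (t - T)) * (-a₀ * 1))) t := fun t =>
    ((((hasDerivAt_id t).sub_const T).const_mul (-a₀)).exp.const_mul K).const_add d
  have hle : ∀ t, T ≤ t → f t ≤ d + K * Real.exp (-a₀ * (t - T)) := by
    intro t ht
    refine image_le_of_deriv_right_lt_deriv_boundary (f := f) (f' := f') (a := T) (b := t)
      (fun s hs => (hT s hs.1).1.continuousAt.continuousWithinAt)
      (fun s hs => (hT s hs.1).1.hasDerivWithinAt) ?_ hBd ?_ ⟨ht, le_rfl⟩
    · simp only [sub_self, mul_zero, Real.exp_zero, mul_one]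
      linarith [le_abs_self (f T - d)]
    -- At a contact point, with `E` the exponential term, `f' ≤ a (b - d - E) < -a₀ E`, the slope of
    -- the barrier; strictness comes from `b < d`.
    · intro s hs hfs
      obtain ⟨-, h1, h2⟩ := hT s hs.1
      have hE : 0 ≤ K * Real.exp (-a₀ * (s - T)) := by positivity
      rw [hfs] at h2
      nlinarith [mul_nonneg (sub_nonneg.2 h1) hE,
        mul_pos (ha₀.trans_le h1) (sub_pos.2 hbd)]
  have hlim : Tendsto (fun t => d + K * Real.exp (-a₀ * (t - T))) atTop (𝓝 (d + K * 0)) := by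
    refine ((Real.tendsto_exp_atBot.comp ?_).const_mul K).const_add d
    exact (tendsto_atTop_add_const_right _ (-T) tendsto_id).const_mul_atTop_of_neg (by linarith)
  filter_upwards [hlim.eventually_lt_const (u := c) (by simpa using hdc),
    eventually_ge_atTop T] with t h1 h2
  exact (hle t h2).trans_lt h1

/-- Relaxation: if `f' = a (g - f)` with `a` bounded below by a positive constant and `g → L`,
then `f → L`. -/
theorem tendsto_of_hasDerivAt_relaxation {f a g : ℝ → ℝ} {a₀ L : ℝ} (ha₀ : 0 < a₀)
    (hf : ∀ᶠ t in atTop, HasDerivAt f (a t * (g t - f t)) t) (ha : ∀ᶠ t in atTop, a₀ ≤ a t)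
    (hg : Tendsto g atTop (𝓝 L)) : Tendsto f atTop (𝓝 L) := by
  refine tendsto_order.2 ⟨fun c hc => ?_, fun c hc => ?_⟩
  · obtain ⟨b, hcb, hbL⟩ := exists_between hc
    have := eventually_lt_of_deriv_le (f := fun t => -f t) (b := -b) (c := -c) ha₀ (neg_lt_neg hcb)
      (hf.mono fun t h => h.neg) ha (by
        filter_upwards [ha, hg.eventually_const_lt hbL] with t h1 h2
        nlinarith [mul_pos (ha₀.trans_le h1) (sub_pos.2 h2)])
    exact this.mono fun t h => neg_lt_neg_iff.1 h
  · obtain ⟨b, hLb, hbc⟩ := exists_between hc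
    refine eventually_lt_of_deriv_le (b := b) ha₀ hbc hf ha ?_
    filter_upwards [ha, hg.eventually_lt_const hLb] with t h1 h2
    nlinarith [mul_pos (ha₀.trans_le h1) (sub_pos.2 h2)]

/-- A function whose derivative is eventually at least `c` grows at least like `c t`. -/
theorem exists_mul_add_le_of_le_deriv {f f' : ℝ → ℝ} {c : ℝ}
    (hf : ∀ᶠ t in atTop, HasDerivAt f (f' t) t) (hf' : ∀ᶠ t in atTop, c ≤ f' t) :
    ∃ C, ∀ᶠ t in atTop, c * t + C ≤ f t := by
  obtain ⟨T, hT⟩ := eventually_atTop.1 (hf.and hf')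
  refine ⟨f T - c * T, eventually_atTop.2 ⟨T, fun t ht => ?_⟩⟩
  have := (convex_Ici T).mul_sub_le_image_sub_of_le_deriv (f := f) (C := c)
    (fun s hs => (hT s hs).1.continuousAt.continuousWithinAt)
    (fun s hs => (hT s (interior_subset hs)).1.differentiableAt.differentiableWithinAt)
    (fun s hs => by
      rw [(hT s (interior_subset hs)).1.deriv]
      exact (hT s (interior_subset hs)).2) T Set.self_mem_Ici t ht ht
  linarith

/-- If `f' → L` at infinity then `f t / t → L`. -/
theorem tendsto_div_id_of_tendsto_deriv {f f' : ℝ → ℝ} {L : ℝ}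
    (hf : ∀ᶠ t in atTop, HasDerivAt f (f' t) t) (hf' : Tendsto f' atTop (𝓝 L)) :
    Tendsto (fun t => f t / t) atTop (𝓝 L) := by
  have lower : ∀ {h h' : ℝ → ℝ} {M c : ℝ}, (∀ᶠ t in atTop, HasDerivAt h (h' t) t) →
      Tendsto h' atTop (𝓝 M) → c < M → ∀ᶠ t in atTop, c < h t / t := by
    intro h h' M c hh hh' hc
    obtain ⟨b, hcb, hbM⟩ := exists_between hc
    obtain ⟨C, hC⟩ := exists_mul_add_le_of_le_deriv hh
      ((hh'.eventually_const_lt hbM).mono fun t ht => ht.le)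
    have hlim : Tendsto (fun t : ℝ => (b - c) * t) atTop atTop :=
      tendsto_id.const_mul_atTop (sub_pos.2 hcb)
    filter_upwards [hC, hlim.eventually_gt_atTop (-C), eventually_gt_atTop 0] with t h1 h2 h3
    rw [lt_div_iff₀ h3]
    linarith
  refine tendsto_order.2 ⟨fun c hc => lower hf hf' hc, fun c hc => ?_⟩
  filter_upwards [lower (hf.mono fun t h => h.neg) hf'.neg (neg_lt_neg hc)] with t ht
  rw [Pi.neg_apply, neg_div] at ht
  exact neg_lt_neg_iff.1 ht

namespace IsNonnegSolution

variable {α : ℝ} {x y : ℝ → ℝ}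

theorem hasDerivAt_y (h : IsNonnegSolution α x y) {t : ℝ} (ht : 0 < t) :
    HasDerivAt y (α - x t * y t) t :=
  (h.deriv_y t ht.le).hasDerivAt (Ici_mem_nhds ht)

theorem hasDerivAt_x (h : IsNonnegSolution α x y) {t : ℝ} (ht : 0 < t) :
    HasDerivAt x (α - x t ^ 2 - x t * y t) t :=
  (h.deriv_x t ht.le).hasDerivAt (Ici_mem_nhds ht)

theorem hasDerivAt_y_sub_x (h : IsNonnegSolution α x y) {t : ℝ} (ht : 0 < t) :
    HasDerivAt (fun s => y s - x s) (x t ^ 2) t :=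
  ((h.hasDerivAt_y ht).sub (h.hasDerivAt_x ht)).congr_deriv (by ring)

theorem eventually_x_lt (h : IsNonnegSolution α x y) : ∀ᶠ t in atTop, x t < (α + 3) / 2 := by
  refine eventually_lt_of_deriv_le (a := fun _ => 2) (b := (α + 1) / 2) two_pos (by linarith)
    ((eventually_gt_atTop 0).mono fun t ht => h.hasDerivAt_x ht) (Eventually.of_forall fun _ => le_rfl)
    ?_
  filter_upwards [eventually_ge_atTop 0] with t ht
  -- `x' ≤ α - x² ≤ α + 1 - 2 x`.
  nlinarith [sq_nonneg (x t - 1), mul_nonneg (h.nonneg_x t ht) (h.nonneg_y t ht)]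

theorem monotoneOn_y_sub_x (h : IsNonnegSolution α x y) :
    MonotoneOn (fun t => y t - x t) (Set.Ioi 0) := by
  refine monotoneOn_of_deriv_nonneg (convex_Ioi 0)
    (fun s hs => (h.hasDerivAt_y_sub_x hs).continuousAt.continuousWithinAt)
    (fun s hs => (h.hasDerivAt_y_sub_x (interior_subset hs)).differentiableAt.differentiableWithinAt)
    (fun s hs => ?_)
  rw [(h.hasDerivAt_y_sub_x (interior_subset hs)).deriv]
  positivity

/-- If `y - x ≤ M`, then `x + y ≤ M + 2 x` is eventually at most `S`, so `x' ≥ α - S x` keeps `x`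
above `α / (2 S)`. Then `(y - x)' = x²` is bounded below by a positive constant, a contradiction. -/
theorem exists_lt_y_sub_x (h : IsNonnegSolution α x y) (hα : 0 < α) (M : ℝ) :
    ∃ t, 0 < t ∧ M < y t - x t := by
  by_contra! hM
  set S := |M| + α + 3 with hS
  have hSpos : 0 < S := by positivity
  have hx : ∀ᶠ t in atTop, -x t < -(α / (2 * S)) := by
    refine eventually_lt_of_deriv_le (f := fun t => -x t) (a := fun _ => S) (b := -(α / S)) hSpos
      ?_ ((eventually_gt_atTop 0).mono fun t ht => (h.hasDerivAt_x ht).neg)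
      (Eventually.of_forall fun _ => le_rfl) ?_
    · rw [neg_lt_neg_iff]
      exact div_lt_div_of_pos_left hα hSpos (by linarith)
    · filter_upwards [eventually_gt_atTop 0, h.eventually_x_lt] with t ht hxt
      have hle : x t + y t ≤ S := by linarith [hM t ht, le_abs_self M]
      have heq : S * (-(α / S) - -x t) = -α + S * x t := by
        field_simp
        ring
      rw [heq]
      nlinarith [mul_le_mul_of_nonneg_right hle (h.nonneg_x t ht.le)]
  have hc : 0 < α / (2 * S) := by positivity
  obtain ⟨C, hC⟩ := exists_mul_add_le_of_le_deriv (f := fun t => y t - x t)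
    (f' := fun t => x t ^ 2) (c := (α / (2 * S)) ^ 2)
    ((eventually_gt_atTop 0).mono fun t ht => h.hasDerivAt_y_sub_x ht)
    (hx.mono fun t ht => pow_le_pow_left₀ hc.le (by linarith) 2)
  have hlim : Tendsto (fun t : ℝ => (α / (2 * S)) ^ 2 * t) atTop atTop :=
    tendsto_id.const_mul_atTop (by positivity)
  obtain ⟨t, h1, h2, h3⟩ :=
    (hC.and ((hlim.eventually_gt_atTop (M - C)).and (eventually_gt_atTop 0))).exists
  linarith [hM t h3]

theorem tendsto_y (h : IsNonnegSolution α x y) (hα : 0 < α) : Tendsto y atTop atTop := by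
  refine tendsto_atTop.2 fun M => ?_
  obtain ⟨T, hT, hMT⟩ := h.exists_lt_y_sub_x hα M
  filter_upwards [eventually_ge_atTop T] with t ht
  have : y T - x T ≤ y t - x t := h.monotoneOn_y_sub_x hT (hT.trans_le ht) ht
  linarith [h.nonneg_x t (hT.le.trans ht)]

theorem tendsto_x_add_y (h : IsNonnegSolution α x y) (hα : 0 < α) :
    Tendsto (fun t => x t + y t) atTop atTop :=
  tendsto_atTop_mono' _ ((eventually_ge_atTop 0).mono fun t ht => by
    linarith [h.nonneg_x t ht]) (h.tendsto_y hα)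

theorem tendsto_x (h : IsNonnegSolution α x y) (hα : 0 < α) : Tendsto x atTop (𝓝 0) := by
  have hs := h.tendsto_x_add_y hα
  refine tendsto_of_hasDerivAt_relaxation (a := fun t => x t + y t)
    (g := fun t => α / (x t + y t)) one_pos ?_ (hs.eventually_ge_atTop 1)
    (hs.const_div_atTop α)
  filter_upwards [eventually_gt_atTop 0, hs.eventually_gt_atTop 0] with t ht h1
  refine (h.hasDerivAt_x ht).congr_deriv ?_
  field_simp
  ring

theorem tendsto_x_div_y (h : IsNonnegSolution α x y) (hα : 0 < α) :
    Tendsto (fun t => x t / y t) atTop (𝓝 0) :=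
  (h.tendsto_x hα).div_atTop (h.tendsto_y hα)

/-- Relaxation for `u = x y`: `u' = (x + y) (α - u) - x² y`. -/
theorem tendsto_x_mul_y (h : IsNonnegSolution α x y) (hα : 0 < α) :
    Tendsto (fun t => x t * y t) atTop (𝓝 α) := by
  have hs := h.tendsto_x_add_y hα
  have hy := h.tendsto_y hα
  have hg : Tendsto (fun t => α - x t ^ 2 / (x t / y t + 1)) atTop (𝓝 α) := by
    simpa using (((h.tendsto_x hα).pow 2).div ((h.tendsto_x_div_y hα).add_const 1)
      (by norm_num)).const_sub α
  refine tendsto_of_hasDerivAt_relaxation (a := fun t => x t + y t) one_pos ?_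
    (hs.eventually_ge_atTop 1) hg
  filter_upwards [eventually_gt_atTop 0, hs.eventually_gt_atTop 0,
    hy.eventually_gt_atTop 0] with t ht h1 h2
  refine ((h.hasDerivAt_x ht).mul (h.hasDerivAt_y ht)).congr_deriv ?_
  have : x t / y t + 1 = (x t + y t) / y t := by field_simp
  rw [this]
  field_simp
  ring

/-- With `z = α - x y` and `w = z y²`, one has `w' = x² y³ - (x + y - 2 z / y) w`; the rate in
brackets is asymptotic to `y`, and the quotient `x² y³ / y` is `(x y)² → α²`. -/
theorem tendsto_deriv_y_mul_sq (h : IsNonnegSolution α x y) (hα : 0 < α) :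
    Tendsto (fun t => (α - x t * y t) * y t ^ 2) atTop (𝓝 (α ^ 2)) := by
  have hy := h.tendsto_y hα
  have hu := h.tendsto_x_mul_y hα
  have hz : Tendsto (fun t => α - x t * y t) atTop (𝓝 0) := by simpa using hu.const_sub α
  have hr : Tendsto (fun t => x t / y t + 1 - 2 * ((α - x t * y t) / y t / y t)) atTop (𝓝 1) := by
    simpa using ((h.tendsto_x_div_y hα).add_const 1).sub
      (((hz.div_atTop hy).div_atTop hy).const_mul 2)
  have hg : Tendsto (fun t => (x t * y t) ^ 2 /
      (x t / y t + 1 - 2 * ((α - x t * y t) / y t / y t))) atTop (𝓝 (α ^ 2)) := by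
    have := (hu.pow 2).div hr one_ne_zero
    rwa [div_one] at this
  refine tendsto_of_hasDerivAt_relaxation
    (a := fun t => y t * (x t / y t + 1 - 2 * ((α - x t * y t) / y t / y t))) one_pos ?_
    ((hy.atTop_mul_pos one_pos hr).eventually_ge_atTop 1) hg
  filter_upwards [eventually_gt_atTop 0, hy.eventually_gt_atTop 0,
    hr.eventually_const_lt one_pos] with t ht h1 h2
  refine ((((h.hasDerivAt_x ht).mul (h.hasDerivAt_y ht)).const_sub α).mul
    ((h.hasDerivAt_y ht).pow 2)).congr_deriv ?_
  rw [mul_assoc (y t), mul_sub (_ - _) (_ / _), mul_div_cancel₀ _ h2.ne']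
  simp only [Pi.mul_apply, Pi.pow_apply]
  field_simp
  ring

theorem tendsto_y_cube_div (h : IsNonnegSolution α x y) (hα : 0 < α) :
    Tendsto (fun t => y t ^ 3 / t) atTop (𝓝 (3 * α ^ 2)) :=
  tendsto_div_id_of_tendsto_deriv (f := fun t => y t ^ 3)
    ((eventually_gt_atTop 0).mono fun t ht =>
      ((h.hasDerivAt_y ht).pow 3).congr_deriv (by push_cast; ring))
    ((h.tendsto_deriv_y_mul_sq hα).const_mul 3)

theorem tendsto_y_normalized (h : IsNonnegSolution α x y) (hα : 0 < α) :
    Tendsto (fun t : ℝ => (3 * α ^ 2 * t) ^ (-(1 / 3) : ℝ) * y t) atTop (𝓝 1) := by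
  have h1 : Tendsto (fun t => (y t ^ 3 / t / (3 * α ^ 2)) ^ (1 / 3 : ℝ)) atTop (𝓝 1) := by
    have := ((h.tendsto_y_cube_div hα).div_const (3 * α ^ 2)).rpow_const (p := 1 / 3)
      (Or.inr (by norm_num))
    rwa [div_self (by positivity), Real.one_rpow] at this
  refine h1.congr' ?_
  filter_upwards [eventually_gt_atTop 0] with t ht
  have hy := h.nonneg_y t ht.le
  have : y t ^ 3 / t / (3 * α ^ 2) = y t ^ 3 / (3 * α ^ 2 * t) := by field_simp
  rw [this, Real.div_rpow (by positivity) (by positivity), Real.rpow_neg (by positivity),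
    ← Real.rpow_natCast, ← Real.rpow_mul hy]
  norm_num
  ring

end IsNonnegSolution

/-- Brings the normalizations of (i) and (iii) to the base `3 α² t` used for `y`. -/
theorem rpow_three_div_mul {α t : ℝ} (hα : 0 < α) (ht : 0 < t) (p : ℝ) :
    (3 / α * t) ^ p = (3 * α ^ 2 * t) ^ p / α ^ (3 * p) := by
  have : 3 / α * t = 3 * α ^ 2 * t / α ^ (3 : ℝ) := by
    norm_cast
    field_simp
  rw [this, Real.div_rpow (by positivity) (by positivity), ← Real.rpow_mul hα.le]

theorem proposition2 (α : ℝ) (hα : 0 < α) (x y : ℝ → ℝ) (hxy : IsNonnegSolution α x y) :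
    Tendsto (fun t : ℝ => (3 / α * t) ^ (1 / 3 : ℝ) * x t) atTop (𝓝 1) ∧
    Tendsto (fun t : ℝ => (3 * α ^ 2 * t) ^ (-(1 / 3) : ℝ) * y t) atTop (𝓝 1) ∧
    Tendsto (fun t : ℝ => (3 / α * t) ^ (2 / 3 : ℝ) * (α - x t * y t)) atTop (𝓝 1) := by
  have hq := hxy.tendsto_y_normalized hα
  refine ⟨?_, hq, ?_⟩
  -- The function in (i) is `(x y / α) / q`, where `q` is the normalized `y` of (ii).
  · have hlim := ((hxy.tendsto_x_mul_y hα).div_const α).div hq one_ne_zero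
    rw [div_self hα.ne', div_one] at hlim
    refine hlim.congr' ?_
    filter_upwards [eventually_gt_atTop 0, (hxy.tendsto_y hα).eventually_gt_atTop 0] with t ht hy
    have hb : 0 < 3 * α ^ 2 * t := by positivity
    rw [rpow_three_div_mul hα ht, Pi.div_apply, Real.rpow_neg hb.le]
    have hp := Real.rpow_pos_of_pos hb (1 / 3)
    norm_num at hp ⊢
    field_simp
  -- The function in (iii) is `((α - x y) y² / α²) / q²`.
  · have hlim := ((hxy.tendsto_deriv_y_mul_sq hα).div_const (α ^ 2)).div (hq.pow 2)
      (by norm_num)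
    rw [div_self (by positivity), one_pow, div_one] at hlim
    refine hlim.congr' ?_
    filter_upwards [eventually_gt_atTop 0, (hxy.tendsto_y hα).eventually_gt_atTop 0] with t ht hy
    have hb : 0 < 3 * α ^ 2 * t := by positivity
    have hp := Real.rpow_pos_of_pos hb (1 / 3)
    have h2 : (3 * α ^ 2 * t) ^ (2 / 3 : ℝ) = ((3 * α ^ 2 * t) ^ (1 / 3 : ℝ)) ^ 2 := by
      rw [← Real.rpow_mul_natCast hb.le]
      norm_num
    have h3 : α ^ (3 * (2 / 3) : ℝ) = α ^ 2 := by
      rw [← Real.rpow_natCast]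
      norm_num
    rw [rpow_three_div_mul hα ht, Pi.div_apply, Real.rpow_neg hb.le, h2, h3]
    field_simp
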